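/- \textbf{Proposition (Slow mixing with mismatched prior).} For $\sigma>0$, $\alpha>0$ and $P\in\mathbb N$, consider on $\mathbb{R}^P$ the elliptical slice sampler with target $\mu=\mathcal N(\mathbf 0,\sigma^2\mathbf I_P)$ and prior $\pi_0=\mathcal N(\mathbf 0,(1+\alpha)\sigma^2\mathbf I_P)$, that is, with likelihood $\mathcal L=\mathrm d\mu/\mathrm d\pi_0$ given by the ratio of the two Gaussian densities, so that $\mathcal L(\mathbf x)\propto\exp\left(-\frac{\|\mathbf x\|^2}{2\sigma^2(1+\alpha^{-1})}\right)$. From a state $\mathbf x$, its transition kernel $H(\mathbf x,\cdot)$ is the law of $\mathbf x\cos\theta+\mathbf z\sin\theta$, where $\mathbf z\sim\pi_0$ and $y\sim\mathcal U_{[0,1]}$ are independent, and, given $\mathbf z$ and $y$, the angle $\theta$ is produced by the shrinkage procedure on the slice $$S(y;\mathbf x,\mathbf z)=\{\theta \mid \mathcal L(\mathbf x\cos\theta+\mathbf z\sin\theta)\ge y\,\mathcal L(\mathbf x)\}:$$ draw $\theta\sim\mathcal U_{[0,2\pi]}$ and set the bracket to $[\theta-2\pi,\theta]$; while $\theta\notin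 S(y;\mathbf x,\mathbf z)$, replace the lower end of the bracket by $\theta$ if $\theta<0$ and the upper end by $\theta$ otherwise, and draw a new $\theta$ uniformly from the bracket. Let $H^n$ denote the $n$-step transition kernel, and let $\|\nu-\mu\|_{TV}=\sup_A|\nu(A)-\mu(A)|$, the supremum being over Borel sets $A\subseteq\mathbb R^P$. For every $\alpha>0$ and every $\varepsilon\in(0,1)$ there exists $P_\alpha\in\mathbb N$ (depending only on $\alpha$ and $\varepsilon$) such that for every $\sigma>0$ and every $P>P_\alpha$, with $N=\left\lfloor\frac{\sqrt{P(1+\alpha)}}{4\log P}\right\rfloor$, $$\left\|H^N(\mathbf 0,\cdot)-\mu\right\|_{TV}\ge 1-\varepsilon .$$ -/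

import Mathlib

namespace EllipticalSlice

open MeasureTheory ProbabilityTheory

noncomputable section

/-- `ℝ^P` with the Euclidean norm. -/
abbrev Space (P : ℕ) : Type := EuclideanSpace ℝ (Fin P)

/-! ### Isotropic Gaussians -/

/-- The Gaussian distribution `N(0, v I_P)` on `ℝ^P`. -/
def isoGaussian (P : ℕ) (v : ℝ) : Measure (Space P) :=
  multivariateGaussian 0 (v • (1 : Matrix (Fin P) (Fin P) ℝ))

instance (P : ℕ) (v : ℝ) : IsProbabilityMeasure (isoGaussian P v) := by
  unfold isoGaussian; infer_instance

/-- The Lebesgue density of `N(0, v I_P)`, for `v > 0`. -/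
def isoGaussianDensity (P : ℕ) (v : ℝ) (x : Space P) : ℝ :=
  (Real.sqrt (2 * Real.pi * v) ^ P)⁻¹ * Real.exp (-‖x‖ ^ 2 / (2 * v))

/-- The likelihood of the target `N(0, σ² I_P)` relative to the prior `N(0, (1 + α) σ² I_P)`:
the ratio of the two densities. -/
def gaussianLikelihood (P : ℕ) (σ α : ℝ) (x : Space P) : ℝ :=
  isoGaussianDensity P (σ ^ 2) x / isoGaussianDensity P ((1 + α) * σ ^ 2) x

/-! ### The shrinkage procedure

`u 0, u 1, …` are independent uniform variables on `[0, 1]`.  The first angle `2π (u 0)` is uniform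
on `[0, 2π]`, and its bracket is the interval of length `2π` that ends in it.  As long as the
proposed angle is rejected, the bracket is shrunk to the part of it, cut at the rejected angle, that
contains the angle `0` of the current state, and the next angle is uniform on the new bracket.
Which angles are proposed depends on the slice only through the time at which the procedure stops.
-/

/-- The `n`-th proposed angle together with the lower and upper end of its bracket, when all
proposals before it have been rejected. -/
def proposal (u : ℕ → ℝ) : ℕ → ℝ × ℝ × ℝ
  | 0 => (2 * Real.pi * u 0, 2 * Real.pi * u 0 - 2 * Real.pi, 2 * Real.pi * u 0)
  | n + 1 =>
    let θ := (proposal u n).1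
    let lo := if θ < 0 then θ else (proposal u n).2.1
    let hi := if θ < 0 then (proposal u n).2.2 else θ
    (lo + u (n + 1) * (hi - lo), lo, hi)

open Classical in
/-- The angle returned by the shrinkage procedure on the slice `S`: the first proposed angle in `S`.
(If there were none, which has probability zero when `S` is a neighbourhood of `0`, the angle of
the current state is returned.) -/
def shrink (S : Set ℝ) (u : ℕ → ℝ) : ℝ :=
  if h : ∃ n, (proposal u n).1 ∈ S then (proposal u (Nat.find h)).1 else 0

/-! ### The transition kernel of the elliptical slice sampler -/

/-- The ellipse through `x` and `z`. -/
def ellipse {P : ℕ} (x z : Space P) (θ : ℝ) : Space P := Real.cos θ • x + Real.sin θ • z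

/-- The angles at which the likelihood on the ellipse is at least `y * L x`. -/
def slice {P : ℕ} (L : Space P → ℝ) (y : ℝ) (x z : Space P) : Set ℝ :=
  {θ | y * L x ≤ L (ellipse x z θ)}

/-- The randomness used in one transition: the prior draw `z`, the variable `y` that determines the
threshold `y * L x`, and the variables used by the shrinkage procedure. -/
abbrev Seed (P : ℕ) : Type := Space P × ℝ × (ℕ → ℝ)

/-- The uniform distribution on `[0, 1]`. -/
def uniform01 : Measure ℝ := volume.restrict (Set.Icc 0 1)

instance : IsProbabilityMeasure uniform01 := ⟨by simp [uniform01]⟩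

/-- `z` has the prior distribution, `y` and the `u n` are uniform on `[0, 1]`, and all of them are
independent. -/
def seedMeasure {P : ℕ} (π₀ : Measure (Space P)) : Measure (Seed P) :=
  π₀.prod (uniform01.prod (Measure.infinitePi fun _ : ℕ => uniform01))

instance {P : ℕ} (π₀ : Measure (Space P)) [IsProbabilityMeasure π₀] :
    IsProbabilityMeasure (seedMeasure π₀) := by
  unfold seedMeasure; infer_instance

/-- One transition from the state `x`. -/
def step {P : ℕ} (L : Space P → ℝ) (x : Space P) (s : Seed P) : Space P :=
  ellipse x s.1 (shrink (slice L s.2.1 x s.1) s.2.2)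

theorem measurable_proposal (n : ℕ) : Measurable fun u : ℕ → ℝ => proposal u n := by
  induction n with
  | zero => simp only [proposal]; fun_prop
  | succ n ih =>
    have hθ : MeasurableSet {u : ℕ → ℝ | (proposal u n).1 < 0} :=
      measurableSet_lt ih.fst measurable_const
    have hlo : Measurable fun u : ℕ → ℝ =>
        if (proposal u n).1 < 0 then (proposal u n).1 else (proposal u n).2.1 :=
      Measurable.ite hθ ih.fst ih.snd.fst
    have hhi : Measurable fun u : ℕ → ℝ =>
        if (proposal u n).1 < 0 then (proposal u n).2.2 else (proposal u n).1 :=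
      Measurable.ite hθ ih.snd.snd ih.fst
    simp only [proposal]
    exact (hlo.add ((measurable_pi_apply (n + 1)).mul (hhi.sub hlo))).prodMk (hlo.prodMk hhi)

theorem measurable_step {P : ℕ} {L : Space P → ℝ} (hL : Measurable L) :
    Measurable fun p : Space P × Seed P => step L p.1 p.2 := by
  classical
  have hprop (n : ℕ) : Measurable fun p : Space P × Seed P => (proposal p.2.2.2 n).1 :=
    ((measurable_proposal n).comp (by fun_prop)).fst
  have hell {f : Space P × Seed P → ℝ} (hf : Measurable f) :
      Measurable fun p : Space P × Seed P => ellipse p.1 p.2.1 (f p) := by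
    unfold ellipse
    exact ((Real.measurable_cos.comp hf).smul measurable_fst).add
      ((Real.measurable_sin.comp hf).smul (by fun_prop))
  have hset (n : ℕ) : MeasurableSet {p : Space P × Seed P |
      (proposal p.2.2.2 n).1 ∈ slice L p.2.2.1 p.1 p.2.1} := by
    have h1 : Measurable fun p : Space P × Seed P => p.2.2.1 * L p.1 :=
      (by fun_prop : Measurable fun p : Space P × Seed P => p.2.2.1).mul
        (hL.comp measurable_fst)
    exact measurableSet_le h1 (hL.comp (hell (hprop n)))
  have key : Measurable fun p : Space P × Seed P =>
      shrink (slice L p.2.2.1 p.1 p.2.1) p.2.2.2 := by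
    intro t ht
    have : (fun p : Space P × Seed P => shrink (slice L p.2.2.1 p.1 p.2.1) p.2.2.2) ⁻¹' t =
        (⋃ n, ({p | (proposal p.2.2.2 n).1 ∈ slice L p.2.2.1 p.1 p.2.1} ∩
          (⋂ m, ⋂ _ : m < n, {p | (proposal p.2.2.2 m).1 ∈ slice L p.2.2.1 p.1 p.2.1}ᶜ)) ∩
          (fun p => (proposal p.2.2.2 n).1) ⁻¹' t) ∪
        ((⋂ n, {p | (proposal p.2.2.2 n).1 ∈ slice L p.2.2.1 p.1 p.2.1}ᶜ) ∩
          {_p | (0 : ℝ) ∈ t}) := by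
      ext p
      simp only [Set.mem_preimage, Set.mem_union, Set.mem_iUnion, Set.mem_inter_iff,
        Set.mem_iInter, Set.mem_compl_iff, Set.mem_ofPred_eq]
      unfold shrink
      split_ifs with h
      · constructor
        · intro hp
          exact Or.inl ⟨Nat.find h, ⟨Nat.find_spec h, fun m hm => Nat.find_min h hm⟩, hp⟩
        · rintro (⟨n, ⟨hn, hmin⟩, hp⟩ | ⟨hno, _⟩)
          · have : Nat.find h = n := (Nat.find_eq_iff h).2 ⟨hn, fun m hm => hmin m hm⟩
            rwa [this]
          · exact absurd h (by simpa using hno)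
      · constructor
        · intro hp
          exact Or.inr ⟨by simpa using h, hp⟩
        · rintro (⟨n, ⟨hn, _⟩, _⟩ | ⟨_, hp⟩)
          · exact absurd ⟨n, hn⟩ h
          · exact hp
    rw [this]
    refine MeasurableSet.union (MeasurableSet.iUnion fun n => ((hset n).inter ?_).inter
      (hprop n ht)) ((MeasurableSet.iInter fun n => (hset n).compl).inter (.const _))
    exact MeasurableSet.iInter fun m => MeasurableSet.iInter fun _ => (hset m).compl
  exact hell key

/-- The transition kernel `H` of the elliptical slice sampler with prior `π₀` and likelihood `L`:
`H(x, ·)` is the law of one transition from `x`. -/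
def kernel {P : ℕ} (π₀ : Measure (Space P)) [IsProbabilityMeasure π₀] (L : Space P → ℝ)
    (hL : Measurable L) : Kernel (Space P) (Space P) where
  toFun x := (seedMeasure π₀).map (step L x)
  measurable' := by
    have h : (fun x : Space P => (seedMeasure π₀).map (step L x)) = fun x =>
        ((seedMeasure π₀).map (Prod.mk x)).map (fun p : Space P × Seed P => step L p.1 p.2) := by
      funext x
      rw [Measure.map_map (measurable_step hL) measurable_prodMk_left]
      rfl
    rw [h]
    exact (Measure.measurable_map _ (measurable_step hL)).comp Measurable.map_prodMk_left

instance {P : ℕ} (π₀ : Measure (Space P)) [IsProbabilityMeasure π₀] (L : Space P → ℝ)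
    (hL : Measurable L) : IsMarkovKernel (kernel π₀ L hL) :=
  ⟨fun _ => Measure.isProbabilityMeasure_map
    ((measurable_step hL).comp measurable_prodMk_left).aemeasurable⟩

/-! ### The sampler with mismatched Gaussian prior -/

theorem measurable_gaussianLikelihood (P : ℕ) (σ α : ℝ) :
    Measurable (gaussianLikelihood P σ α) := by
  unfold gaussianLikelihood isoGaussianDensity
  fun_prop

/-- The transition kernel of the elliptical slice sampler with target `N(0, σ² I_P)` and prior
`N(0, (1 + α) σ² I_P)`. -/
def mismatchedKernel (P : ℕ) (σ α : ℝ) : Kernel (Space P) (Space P) :=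
  kernel (isoGaussian P ((1 + α) * σ ^ 2)) (gaussianLikelihood P σ α)
    (measurable_gaussianLikelihood P σ α)

theorem isoGaussian_eq_withDensity (P : ℕ) {v : ℝ} (hv : 0 < v) :
    isoGaussian P v =
      volume.withDensity fun x => ENNReal.ofReal (isoGaussianDensity P v x) := by
  have hb : (0 : ℝ) < ((1 / (2 * v) : ℝ) : ℂ).re := by
    rw [Complex.ofReal_re]; positivity
  have hpos (x : Space P) : 0 ≤ isoGaussianDensity P v x := by
    unfold isoGaussianDensity; positivity
  have hmeas : Measurable fun x : Space P => isoGaussianDensity P v x := by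
    unfold isoGaussianDensity; fun_prop
  have hint : Integrable (isoGaussianDensity P v) := by
    have h := (GaussianFourier.integrable_cexp_neg_mul_sq_norm_add hb 0 (0 : Space P)).norm
    have h' := h.const_mul (Real.sqrt (2 * Real.pi * v) ^ P)⁻¹
    refine h'.congr (.of_forall fun x => ?_)
    simp only [isoGaussianDensity, Complex.norm_exp]
    congr 2
    simp [← Complex.ofReal_pow]
    ring
  have hfin : IsFiniteMeasure
      (volume.withDensity fun x => ENNReal.ofReal (isoGaussianDensity P v x)) :=
    isFiniteMeasure_withDensity_ofReal hint.2
  apply Measure.ext_of_charFun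
  funext t
  have hS : (v • (1 : Matrix (Fin P) (Fin P) ℝ)).PosSemidef :=
    Matrix.PosSemidef.one.smul hv.le
  rw [isoGaussian, charFun_multivariateGaussian hS, charFun_apply,
    integral_withDensity_eq_integral_toReal_smul hmeas.ennreal_ofReal
      (.of_forall fun _ => ENNReal.ofReal_lt_top)]
  have h1 : ∀ x : Space P, (ENNReal.ofReal (isoGaussianDensity P v x)).toReal •
      Complex.exp (inner ℝ x t * Complex.I) = ((Real.sqrt (2 * Real.pi * v) ^ P)⁻¹ : ℝ) *
      Complex.exp (-((1 / (2 * v) : ℝ) : ℂ) * ‖x‖ ^ 2 + Complex.I * inner ℝ t x) := by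
    intro x
    rw [ENNReal.toReal_ofReal (hpos x), isoGaussianDensity, Complex.real_smul, Complex.ofReal_mul,
      mul_assoc, Complex.ofReal_exp, ← Complex.exp_add, real_inner_comm]
    congr 2
    push_cast
    ring
  simp_rw [h1]
  rw [integral_const_mul, GaussianFourier.integral_cexp_neg_mul_sq_norm_add hb]
  have h2 : ((Real.pi : ℂ) / ((1 / (2 * v) : ℝ) : ℂ)) ^
      ((Module.finrank ℝ (Space P) : ℂ) / 2) = ((Real.sqrt (2 * Real.pi * v) ^ P : ℝ) : ℂ) := by
    have e1 : (Real.pi : ℂ) / ((1 / (2 * v) : ℝ) : ℂ) = ((2 * Real.pi * v : ℝ) : ℂ) := by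
      push_cast; field_simp
    have e2 : (Module.finrank ℝ (Space P) : ℂ) / 2 = ((1 / 2 * (P : ℝ) : ℝ) : ℂ) := by
      simp [div_eq_inv_mul]
    rw [e1, e2, ← Complex.ofReal_cpow (by positivity), Real.rpow_mul (by positivity),
      Real.rpow_natCast, Real.sqrt_eq_rpow]
  have h3 : t.ofLp ⬝ᵥ (v • (1 : Matrix (Fin P) (Fin P) ℝ)).mulVec t.ofLp = v * ‖t‖ ^ 2 := by
    rw [Matrix.smul_mulVec, Matrix.one_mulVec, dotProduct_smul, EuclideanSpace.real_norm_sq_eq,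
      smul_eq_mul]
    simp [dotProduct, pow_two]
  have h4 : Real.sqrt (2 * Real.pi * v) ^ P ≠ 0 := by positivity
  rw [h2, h3, ← mul_assoc, ← Complex.ofReal_mul, inv_mul_cancel₀ h4, Complex.ofReal_one, one_mul,
    inner_zero_right]
  congr 1
  push_cast
  rw [Complex.I_sq]
  have hv' : (v : ℂ) ≠ 0 := by exact_mod_cast hv.ne'
  field_simp
  ring

/-- The target is the prior weighted by the likelihood. -/
theorem target_eq_withDensity (P : ℕ) {σ α : ℝ} (hσ : 0 < σ) (hα : 0 < α) :
    isoGaussian P (σ ^ 2) = (isoGaussian P ((1 + α) * σ ^ 2)).withDensity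
      fun x => ENNReal.ofReal (gaussianLikelihood P σ α x) := by
  have hd (v : ℝ) (x : Space P) (hv : 0 < v) : 0 < isoGaussianDensity P v x := by
    unfold isoGaussianDensity; positivity
  have hm (v : ℝ) : Measurable fun x : Space P => ENNReal.ofReal (isoGaussianDensity P v x) := by
    unfold isoGaussianDensity; fun_prop
  rw [isoGaussian_eq_withDensity P (by positivity), isoGaussian_eq_withDensity P (by positivity),
    ← withDensity_mul _ (hm _) (measurable_gaussianLikelihood P σ α).ennreal_ofReal]
  congr 1
  funext x
  have h2 := hd ((1 + α) * σ ^ 2) x (by positivity)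
  simp only [Pi.mul_apply]
  rw [← ENNReal.ofReal_mul h2.le, gaussianLikelihood, mul_div_cancel₀ _ h2.ne']

/-- Total variation distance, `sup_A |ν(A) - μ(A)|` over the measurable sets `A`. -/
def tvDist {P : ℕ} (ν μ : Measure (Space P)) : ℝ :=
  ⨆ A : {A : Set (Space P) // MeasurableSet A}, |ν.real A.1 - μ.real A.1|

end

end EllipticalSlice

namespace EllipticalSlice

open MeasureTheory ProbabilityTheory Filter Topology

/-! ### Likelihood and second moment of one transition -/

/-! The chain climbs too slowly out of the origin. An accepted point satisfies `L w ≥ y * L x`, and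
`log L` is a constant minus a multiple of `‖·‖ ^ 2`, so one transition adds at most `2σ²(1 + α)/α *
log (1/y)` to the squared norm, whatever the prior draw and the shrinkage do. Since `log (1/y)` has
mean 1, `n` transitions from `0` give a mean squared norm of at most `n * 2σ²(1 + α)/α`
(`lintegral_kernel_pow_le`).

The set `{P σ²/2 ≤ ‖x‖ ^ 2}` separates the two laws. By Markov's inequality the chain is there with
probability at most `4(1 + α)/α * n/P`; by a Chernoff bound the target misses it with probability at
most `(exp (1/4) / √2) ^ P`. Both vanish as `P → ∞` whenever `n = o(P)`, and `N` is only of order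
`√P / log P`. -/

theorem gaussianLikelihood_eq (P : ℕ) {σ α : ℝ} (hσ : 0 < σ) (hα : 0 < α) (x : Space P) :
    gaussianLikelihood P σ α x =
      gaussianLikelihood P σ α 0 * Real.exp (-(α / (2 * σ ^ 2 * (1 + α)) * ‖x‖ ^ 2)) := by
  have h : -(α / (2 * σ ^ 2 * (1 + α)) * ‖x‖ ^ 2) =
      -‖x‖ ^ 2 / (2 * σ ^ 2) - -‖x‖ ^ 2 / (2 * ((1 + α) * σ ^ 2)) := by
    field_simp
    ring
  rw [h, Real.exp_sub]
  simp only [gaussianLikelihood, isoGaussianDensity]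
  rw [mul_div_mul_comm]
  simp

theorem gaussianLikelihood_pos (P : ℕ) {σ α : ℝ} (hσ : 0 < σ) (hα : 0 < α) (x : Space P) :
    0 < gaussianLikelihood P σ α x := by
  unfold gaussianLikelihood isoGaussianDensity
  positivity

/-- The new state of a transition lies above the likelihood threshold. -/
theorem mul_le_likelihood_step {P : ℕ} {L : Space P → ℝ} {x : Space P} {s : Seed P}
    (hL : 0 ≤ L x) (hy : s.2.1 ≤ 1) : s.2.1 * L x ≤ L (step L x s) := by
  classical
  unfold step shrink
  split_ifs with h
  · exact Nat.find_spec h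
  -- The fallback angle `0` returns `x` itself, which lies in the slice because `y ≤ 1`.
  · simpa [ellipse] using mul_le_of_le_one_left hL hy

/-- One transition increases the squared norm by at most a multiple of `log (1 / y)`. -/
theorem sq_norm_step_le (P : ℕ) {σ α : ℝ} (hσ : 0 < σ) (hα : 0 < α) (x : Space P) (s : Seed P)
    (hy0 : 0 < s.2.1) (hy1 : s.2.1 ≤ 1) :
    ‖step (gaussianLikelihood P σ α) x s‖ ^ 2 ≤
      ‖x‖ ^ 2 + 2 * σ ^ 2 * (1 + α) / α * -Real.log s.2.1 := by
  have h := mul_le_likelihood_step (gaussianLikelihood_pos P hσ hα x).le hy1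
  set w := step (gaussianLikelihood P σ α) x s
  rw [gaussianLikelihood_eq P hσ hα x, gaussianLikelihood_eq P hσ hα w, mul_left_comm] at h
  have h' := le_of_mul_le_mul_left h (gaussianLikelihood_pos P hσ hα 0)
  have h2 := Real.log_le_log (by positivity) h'
  rw [Real.log_mul hy0.ne' (by positivity), Real.log_exp, Real.log_exp] at h2
  set b := α / (2 * σ ^ 2 * (1 + α)) with hb
  have hb0 : 0 < b := by positivity
  have hinv : 2 * σ ^ 2 * (1 + α) / α = b⁻¹ := by rw [hb, inv_div]
  rw [hinv]
  refine le_of_mul_le_mul_left ?_ hb0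
  rw [mul_add, mul_inv_cancel_left₀ hb0.ne']
  linarith

theorem ae_uniform01 : ∀ᵐ y ∂uniform01, 0 < y ∧ y ≤ 1 := by
  have h : ∀ᵐ y ∂(volume : Measure ℝ), y ≠ 0 := by simp [ae_iff]
  unfold uniform01
  filter_upwards [ae_restrict_mem measurableSet_Icc, ae_restrict_of_ae h] with y hy hy0
  exact ⟨lt_of_le_of_ne hy.1 hy0.symm, hy.2⟩

/-- `-log y` is exponential of rate 1; its mean turns the pathwise bound into a constant drift. -/
theorem lintegral_neg_log_uniform01 :
    ∫⁻ y, ENNReal.ofReal (-Real.log y) ∂uniform01 = 1 := by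
  have hI : IntervalIntegrable Real.log volume 0 1 := intervalIntegral.intervalIntegrable_log'
  have hint : Integrable (fun y : ℝ => -Real.log y) uniform01 := by
    unfold uniform01
    exact ((intervalIntegrable_iff_integrableOn_Icc_of_le zero_le_one).1 hI).neg
  rw [← ofReal_integral_eq_lintegral_ofReal hint]
  · unfold uniform01
    rw [integral_Icc_eq_integral_Ioc, ← intervalIntegral.integral_of_le zero_le_one,
      intervalIntegral.integral_neg, integral_log]
    simp
  · filter_upwards [ae_uniform01] with y hy
    exact neg_nonneg.2 (Real.log_nonpos hy.1.le hy.2)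

theorem measurePreserving_seed {P : ℕ} (π₀ : Measure (Space P)) [IsProbabilityMeasure π₀] :
    MeasurePreserving (fun s : Seed P => s.2.1) (seedMeasure π₀) uniform01 :=
  (measurePreserving_fst (μ := uniform01)
    (ν := Measure.infinitePi fun _ : ℕ => uniform01)).comp measurePreserving_snd

theorem lintegral_kernel {P : ℕ} (π₀ : Measure (Space P)) [IsProbabilityMeasure π₀]
    {L : Space P → ℝ} (hL : Measurable L) {f : Space P → ENNReal} (hf : Measurable f)
    (x : Space P) :
    ∫⁻ w, f w ∂(kernel π₀ L hL x) = ∫⁻ s, f (step L x s) ∂(seedMeasure π₀) := by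
  have hstep : Measurable (step L x) :=
    (measurable_step hL).comp (g := fun p : Space P × Seed P => step L p.1 p.2)
      (f := fun s : Seed P => (x, s)) measurable_prodMk_left
  have hk : kernel π₀ L hL x = (seedMeasure π₀).map (step L x) := rfl
  rw [hk, lintegral_map hf hstep]

/-- The increment bound depends on the seed only through `y`, so integrating it needs only the
marginal law of `y`. -/
theorem lintegral_sq_norm_mismatchedKernel_le (P : ℕ) {σ α : ℝ} (hσ : 0 < σ) (hα : 0 < α)
    (x : Space P) :
    ∫⁻ w, ENNReal.ofReal (‖w‖ ^ 2) ∂(mismatchedKernel P σ α x) ≤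
      ENNReal.ofReal (‖x‖ ^ 2) + ENNReal.ofReal (2 * σ ^ 2 * (1 + α) / α) := by
  let g : ℝ → ENNReal := fun y => ENNReal.ofReal (‖x‖ ^ 2) +
    ENNReal.ofReal (2 * σ ^ 2 * (1 + α) / α) * ENNReal.ofReal (-Real.log y)
  have hg : Measurable g := by fun_prop
  have hsnd := measurePreserving_seed (isoGaussian P ((1 + α) * σ ^ 2))
  rw [mismatchedKernel, lintegral_kernel _ _ (f := fun w => ENNReal.ofReal (‖w‖ ^ 2)) (by fun_prop)]
  calc ∫⁻ s, ENNReal.ofReal (‖step (gaussianLikelihood P σ α) x s‖ ^ 2)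
        ∂(seedMeasure (isoGaussian P ((1 + α) * σ ^ 2)))
      ≤ ∫⁻ s, g s.2.1 ∂(seedMeasure (isoGaussian P ((1 + α) * σ ^ 2))) := by
        refine lintegral_mono_ae ?_
        filter_upwards [hsnd.quasiMeasurePreserving.ae ae_uniform01] with s hs
        have hlog : 0 ≤ -Real.log s.2.1 := neg_nonneg.2 (Real.log_nonpos hs.1.le hs.2)
        dsimp only [g]
        rw [← ENNReal.ofReal_mul (by positivity), ← ENNReal.ofReal_add (by positivity)
          (by positivity)]
        exact ENNReal.ofReal_le_ofReal (sq_norm_step_le P hσ hα x s hs.1 hs.2)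
    _ = ∫⁻ y, g y ∂uniform01 := hsnd.lintegral_comp hg
    _ = ENNReal.ofReal (‖x‖ ^ 2) + ENNReal.ofReal (2 * σ ^ 2 * (1 + α) / α) := by
        rw [lintegral_add_left measurable_const, lintegral_const_mul _ (by fun_prop),
          lintegral_neg_log_uniform01]
        simp

/-! ### Several transitions -/

/-- A function whose mean grows by at most `c` in one transition grows in mean by at most `n * c`
in `n` transitions. -/
theorem lintegral_kernel_pow_le {X : Type*} [MeasurableSpace X] (κ : Kernel X X)
    [IsMarkovKernel κ] {f : X → ENNReal} (hf : Measurable f) {c : ENNReal}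
    (h : ∀ x, ∫⁻ w, f w ∂(κ x) ≤ f x + c) (n : ℕ) (x : X) :
    ∫⁻ w, f w ∂((κ ^ n) x) ≤ f x + n * c := by
  induction n generalizing x with
  | zero =>
    rw [pow_zero]
    change ∫⁻ w, f w ∂(Kernel.id x) ≤ _
    rw [Kernel.id_apply, lintegral_dirac' _ hf]
    simp
  | succ n ih =>
    -- Peeling off the first transition leaves `n` transitions from a random point `b`, hence the
    -- induction over all starting points.
    rw [Kernel.pow_add, pow_one, Kernel.lintegral_comp _ _ _ hf]
    calc ∫⁻ b, ∫⁻ w, f w ∂((κ ^ n) b) ∂(κ x)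
        ≤ ∫⁻ b, f b + n * c ∂(κ x) := lintegral_mono ih
      _ = ∫⁻ b, f b ∂(κ x) + n * c := by
        rw [lintegral_add_right _ measurable_const]; simp
      _ ≤ f x + c + n * c := by gcongr; exact h x
      _ = f x + (n + 1 : ℕ) * c := by push_cast; ring

instance isMarkovKernel_pow {X : Type*} [MeasurableSpace X] (κ : Kernel X X) [IsMarkovKernel κ]
    (n : ℕ) : IsMarkovKernel (κ ^ n) := by
  induction n with
  | zero => rw [pow_zero]; exact inferInstanceAs (IsMarkovKernel Kernel.id)
  | succ n ih => rw [Kernel.pow_add, pow_one]; infer_instance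

instance (P : ℕ) (σ α : ℝ) : IsMarkovKernel (mismatchedKernel P σ α) := by
  unfold mismatchedKernel; infer_instance

/-- Markov's inequality for the squared norm, whose initial value at `0` vanishes. -/
theorem mismatchedKernel_pow_real_le (P : ℕ) {σ α : ℝ} (hσ : 0 < σ) (hα : 0 < α) (n : ℕ)
    {r : ℝ} (hr : 0 < r) :
    ((mismatchedKernel P σ α ^ n) 0).real {w | r ≤ ‖w‖ ^ 2} ≤
      n * (2 * σ ^ 2 * (1 + α) / α) / r := by
  have h1 := lintegral_kernel_pow_le (mismatchedKernel P σ α)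
    (f := fun w => ENNReal.ofReal (‖w‖ ^ 2)) (by fun_prop)
    (lintegral_sq_norm_mismatchedKernel_le P hσ hα) n 0
  have h2 := (mul_meas_ge_le_lintegral (μ := (mismatchedKernel P σ α ^ n) 0)
    (f := fun w => ENNReal.ofReal (‖w‖ ^ 2)) (by fun_prop) (ENNReal.ofReal r)).trans h1
  have hset : {w : Space P | ENNReal.ofReal r ≤ ENNReal.ofReal (‖w‖ ^ 2)} =
      {w | r ≤ ‖w‖ ^ 2} := by
    ext w
    exact ENNReal.ofReal_le_ofReal_iff (by positivity)
  rw [hset] at h2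
  rw [le_div_iff₀ hr, mul_comm]
  have h3 := ENNReal.toReal_mono (by finiteness) h2
  rw [ENNReal.toReal_mul, ENNReal.toReal_ofReal hr.le] at h3
  refine h3.trans_eq ?_
  have hc : 0 ≤ 2 * σ ^ 2 * (1 + α) / α := by positivity
  simp [ENNReal.toReal_ofReal hc]

/-! ### Concentration of the target -/

theorem lintegral_isoGaussianDensity (P : ℕ) {v : ℝ} (hv : 0 < v) :
    ∫⁻ x, ENNReal.ofReal (isoGaussianDensity P v x) = 1 := by
  have h := measure_univ (μ := isoGaussian P v)
  rwa [isoGaussian_eq_withDensity P hv, withDensity_apply _ .univ, Measure.restrict_univ] at h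

/-- The ratio of the densities with variances `σ²` and `σ²/2` is `2 ^ (-P/2) * exp (‖x‖ ^ 2 /
(2σ²))`, and the exponential is at most `exp (P/4)` on this ball. -/
theorem isoGaussianDensity_le_of_sq_norm_le (P : ℕ) {σ : ℝ} (hσ : 0 < σ) (x : Space P)
    (hx : ‖x‖ ^ 2 ≤ P * σ ^ 2 / 2) :
    isoGaussianDensity P (σ ^ 2) x ≤
      (Real.exp (1 / 4) / Real.sqrt 2) ^ P * isoGaussianDensity P (σ ^ 2 / 2) x := by
  have hs : Real.sqrt (2 * Real.pi * σ ^ 2) =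
      Real.sqrt 2 * Real.sqrt (2 * Real.pi * (σ ^ 2 / 2)) := by
    rw [← Real.sqrt_mul (by norm_num)]
    congr 1
    ring
  have he : Real.exp (-‖x‖ ^ 2 / (2 * σ ^ 2)) ≤
      Real.exp (1 / 4) ^ P * Real.exp (-‖x‖ ^ 2 / (2 * (σ ^ 2 / 2))) := by
    rw [← Real.exp_nat_mul, ← Real.exp_add, Real.exp_le_exp]
    have e : -‖x‖ ^ 2 / (2 * (σ ^ 2 / 2)) =
        -‖x‖ ^ 2 / (2 * σ ^ 2) - ‖x‖ ^ 2 / (2 * σ ^ 2) := by field_simp; ring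
    have e2 : ‖x‖ ^ 2 / (2 * σ ^ 2) ≤ P * (1 / 4) := by
      rw [div_le_iff₀ (by positivity)]
      linarith
    rw [e]
    linarith
  unfold isoGaussianDensity
  rw [hs, mul_pow, div_pow, mul_inv]
  calc _ ≤ (Real.sqrt 2 ^ P)⁻¹ * (Real.sqrt (2 * Real.pi * (σ ^ 2 / 2)) ^ P)⁻¹ *
        (Real.exp (1 / 4) ^ P * Real.exp (-‖x‖ ^ 2 / (2 * (σ ^ 2 / 2)))) := by gcongr
    _ = _ := by ring

/-- Chernoff bound by change of measure: the comparison with variance `σ²/2` is integrated over the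
ball, where that Gaussian has mass at most 1. -/
theorem isoGaussian_real_le (P : ℕ) {σ : ℝ} (hσ : 0 < σ) :
    (isoGaussian P (σ ^ 2)).real {x | P * σ ^ 2 / 2 ≤ ‖x‖ ^ 2}ᶜ ≤
      (Real.exp (1 / 4) / Real.sqrt 2) ^ P := by
  have hA : MeasurableSet {x : Space P | P * σ ^ 2 / 2 ≤ ‖x‖ ^ 2}ᶜ :=
    (measurableSet_le measurable_const (by fun_prop)).compl
  have hm : Measurable fun x : Space P => ENNReal.ofReal (isoGaussianDensity P (σ ^ 2 / 2) x) := by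
    unfold isoGaussianDensity; fun_prop
  refine ENNReal.toReal_le_of_le_ofReal (by positivity) ?_
  rw [isoGaussian_eq_withDensity P (by positivity), withDensity_apply _ hA]
  calc ∫⁻ x in {x : Space P | P * σ ^ 2 / 2 ≤ ‖x‖ ^ 2}ᶜ,
        ENNReal.ofReal (isoGaussianDensity P (σ ^ 2) x)
      ≤ ∫⁻ x in {x : Space P | P * σ ^ 2 / 2 ≤ ‖x‖ ^ 2}ᶜ,
        ENNReal.ofReal ((Real.exp (1 / 4) / Real.sqrt 2) ^ P) *
          ENNReal.ofReal (isoGaussianDensity P (σ ^ 2 / 2) x) := by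
        refine setLIntegral_mono (hm.const_mul _) fun x hx => ?_
        rw [← ENNReal.ofReal_mul (by positivity)]
        exact ENNReal.ofReal_le_ofReal
          (isoGaussianDensity_le_of_sq_norm_le P hσ x
            (by simpa using hx : ‖x‖ ^ 2 < P * σ ^ 2 / 2).le)
    _ ≤ ∫⁻ x, ENNReal.ofReal ((Real.exp (1 / 4) / Real.sqrt 2) ^ P) *
          ENNReal.ofReal (isoGaussianDensity P (σ ^ 2 / 2) x) := setLIntegral_le_lintegral _ _
    _ = ENNReal.ofReal ((Real.exp (1 / 4) / Real.sqrt 2) ^ P) := by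
        rw [lintegral_const_mul _ hm, lintegral_isoGaussianDensity P (by positivity), mul_one]

theorem exp_quarter_div_sqrt_two_lt_one : Real.exp (1 / 4) / Real.sqrt 2 < 1 := by
  rw [div_lt_one (by positivity)]
  refine Real.lt_sqrt_of_sq_lt ?_
  -- After raising to the fourth power the claim is `e < 4`.
  have h : (Real.exp (1 / 4) ^ 2) ^ 2 < 2 ^ 2 := by
    rw [← pow_mul, ← Real.exp_nat_mul]
    norm_num
    linarith [Real.exp_one_lt_d9]
  exact lt_of_pow_lt_pow_left₀ 2 (by norm_num) h

/-! ### Total variation -/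

theorem abs_real_sub_real_le_tvDist {P : ℕ} (ν μ : Measure (Space P)) [IsProbabilityMeasure ν]
    [IsProbabilityMeasure μ] {A : Set (Space P)} (hA : MeasurableSet A) :
    |ν.real A - μ.real A| ≤ tvDist ν μ := by
  -- A real supremum bounds its terms only if the family is bounded above; here 1 is a bound.
  refine le_ciSup (f := fun A : {A : Set (Space P) // MeasurableSet A} =>
    |ν.real A.1 - μ.real A.1|) ⟨1, ?_⟩ ⟨A, hA⟩
  rintro _ ⟨B, rfl⟩
  have h1 : ν.real B.1 ≤ 1 := measureReal_le_one
  have h2 : μ.real B.1 ≤ 1 := measureReal_le_one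
  have h3 : 0 ≤ ν.real B.1 := measureReal_nonneg
  have h4 : 0 ≤ μ.real B.1 := measureReal_nonneg
  exact abs_le.2 ⟨by linarith, by linarith⟩

/-- Both the drift and the radius scale with `σ²`, so `σ` cancels and the bound is uniform in it. -/
theorem one_sub_le_tvDist_mismatchedKernel_pow {P : ℕ} (hP : 0 < P) {σ α : ℝ} (hσ : 0 < σ)
    (hα : 0 < α) (n : ℕ) :
    1 - (4 * (1 + α) / α * (n / P) + (Real.exp (1 / 4) / Real.sqrt 2) ^ P) ≤
      tvDist ((mismatchedKernel P σ α ^ n) 0) (isoGaussian P (σ ^ 2)) := by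
  have hP' : (0 : ℝ) < P := by exact_mod_cast hP
  have hA : MeasurableSet {x : Space P | P * σ ^ 2 / 2 ≤ ‖x‖ ^ 2} :=
    measurableSet_le measurable_const (by fun_prop)
  refine le_trans ?_ (abs_real_sub_real_le_tvDist _ _ hA)
  have h1 := mismatchedKernel_pow_real_le P hσ hα n (r := P * σ ^ 2 / 2) (by positivity)
  have h2 := isoGaussian_real_le P hσ
  rw [probReal_compl_eq_one_sub hA] at h2
  have h3 : n * (2 * σ ^ 2 * (1 + α) / α) / (P * σ ^ 2 / 2) = 4 * (1 + α) / α * (n / P) := by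
    field_simp
    ring
  rw [h3] at h1
  rw [abs_sub_comm]
  exact le_trans (by linarith) (le_abs_self _)

theorem tendsto_floor_div_atTop (α : ℝ) :
    Tendsto (fun P : ℕ =>
      (⌊Real.sqrt ((P : ℝ) * (1 + α)) / (4 * Real.log (P : ℝ))⌋₊ : ℝ) / P) atTop (𝓝 0) := by
  have hlim : Tendsto (fun P : ℕ => Real.sqrt (1 + α) / Real.sqrt (P : ℝ)) atTop (𝓝 0) :=
    tendsto_const_nhds.div_atTop (Real.tendsto_sqrt_atTop.comp tendsto_natCast_atTop_atTop)
  refine squeeze_zero' (.of_forall fun P => by positivity) ?_ hlim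
  -- From `P = 3 > e` on, `log P ≥ 1`, so the factor `4 log P` can simply be dropped.
  filter_upwards [eventually_ge_atTop 3] with P hP
  have hP3 : (3 : ℝ) ≤ P := by exact_mod_cast hP
  have hP' : (0 : ℝ) < P := by linarith
  have hlog : 1 ≤ Real.log P := by
    rw [Real.le_log_iff_exp_le hP']
    linarith [Real.exp_one_lt_d9]
  have hs : 0 < Real.sqrt (P : ℝ) := Real.sqrt_pos.2 hP'
  calc (⌊Real.sqrt ((P : ℝ) * (1 + α)) / (4 * Real.log (P : ℝ))⌋₊ : ℝ) / P
      ≤ Real.sqrt ((P : ℝ) * (1 + α)) / (4 * Real.log (P : ℝ)) / P := by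
        gcongr
        exact Nat.floor_le (by positivity)
    _ ≤ Real.sqrt ((P : ℝ) * (1 + α)) / P := by
        gcongr
        exact div_le_self (by positivity) (by linarith)
    _ = Real.sqrt (1 + α) / Real.sqrt (P : ℝ) := by
        rw [Real.sqrt_mul hP'.le, div_eq_div_iff hP'.ne' hs.ne', mul_right_comm,
          Real.mul_self_sqrt hP'.le, mul_comm]

end EllipticalSlice

theorem mainTheorem6 (α : ℝ) (hα : 0 < α) (ε : ℝ) (hε : ε ∈ Set.Ioo (0 : ℝ) 1) :
    ∃ Pα : ℕ, ∀ σ : ℝ, 0 < σ → ∀ P : ℕ, Pα < P →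
      1 - ε ≤ EllipticalSlice.tvDist
        ((EllipticalSlice.mismatchedKernel P σ α ^
          ⌊Real.sqrt ((P : ℝ) * (1 + α)) / (4 * Real.log (P : ℝ))⌋₊) 0)
        (EllipticalSlice.isoGaussian P (σ ^ 2)) := by
  have hlim := ((EllipticalSlice.tendsto_floor_div_atTop α).const_mul (4 * (1 + α) / α)).add
    (tendsto_pow_atTop_nhds_zero_of_lt_one (by positivity)
      EllipticalSlice.exp_quarter_div_sqrt_two_lt_one)
  rw [mul_zero, add_zero] at hlim
  -- The error term contains no `σ`, so the threshold can be fixed before `σ`.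
  obtain ⟨Pα, hPα⟩ := Filter.eventually_atTop.1 (hlim.eventually (gt_mem_nhds hε.1))
  refine ⟨Pα, fun σ hσ P hP => ?_⟩
  have h := hPα P hP.le
  exact le_trans (by linarith) (EllipticalSlice.one_sub_le_tvDist_mismatchedKernel_pow
    (Nat.zero_lt_of_lt hP) hσ hα _)
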